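/- An o-minimal structure on $(\mathbf{R},+,\cdot,<)$ is a sequence $(\mathcal{O}_n)_{n\in\mathbf{N}}$, where $\mathcal{O}_n$ is a Boolean algebra of subsets of $\mathbf{R}^n$, such that: $A\times B\in\mathcal{O}_{m+n}$ whenever $A\in\mathcal{O}_m$ and $B\in\mathcal{O}_n$; the image of any $A\in\mathcal{O}_{n+1}$ under the projection $\mathbf{R}^{n+1}\to\mathbf{R}^n$ onto the first $n$ coordinates belongs to $\mathcal{O}_n$; every set $\{x\in\mathbf{R}^n: p(x)=0\}$ with $p$ a real polynomial belongs to $\mathcal{O}_n$; and the elements of $\mathcal{O}_1$ are exactly the finite unions of intervals (bounded or not) and points. A mapping $f:U\to\mathbf{R}^n$, $U\subset\mathbf{R}^m$, is definable if its graph belongs to $\mathcal{O}_{m+n}$ for some o-minimal structure $\mathcal{O}$ on $(\mathbf{R},+,\cdot,<)$. Let $U$ be an open subset of $\mathbf{R}^m$, let $f:U\to\mathbf{R}^n$ be a continuous definable mapping, and let $v\in\mathbf{R}^m$ with Euclidean norm $|v|=1$. Put $$\mathcal{D}_v(f)=\{df(y)v : y\in U,\ f \text{ is differentiable at } y\},$$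 and let $\mathrm{Dir}_v(f)$ be the set of all directional derivatives $$\partial_v f(y)=\lim_{h\to 0^+}\frac{f(y+hv)-f(y)}{h}\in\mathbf{R}^n,$$ where $y$ ranges over the points of $U$ at which this limit exists in $\mathbf{R}^n$. (1) Let $x\in U$ and let $a<b$ be real numbers such that $x+tv\in U$ for all $t\in[a,b]$. Put $g(t)=f(x+tv)$ for $t\in[a,b]$. Then $g'(t)\in\overline{\mathcal{D}_v(f)}$ for every $t\in[a,b]$ at which $g'(t)$ exists (one-sided derivatives being taken at the end points $a$ and $b$). (2) Consequently, $\overline{\mathrm{Dir}_v(f)}=\overline{\mathcal{D}_v(f)}$. -/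

import Mathlib

open Set Filter Topology

/-- An o-minimal structure on `(ℝ, +, ·, <)`: for each `n` a Boolean algebra `sets n` of subsets
of `ℝⁿ` (the definable sets), closed under products and under forgetting the last coordinate,
containing the algebraic sets, and such that the definable subsets of `ℝ` are exactly the
finite unions of intervals and points. -/
structure OMinimalStructure where
  /-- The definable subsets of `ℝⁿ`. -/
  sets : ∀ n : ℕ, BooleanSubalgebra (Set (Fin n → ℝ))
  prod_mem : ∀ {m n : ℕ} {A : Set (Fin m → ℝ)} {B : Set (Fin n → ℝ)},
    A ∈ sets m → B ∈ sets n →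
      {z : Fin (m + n) → ℝ | (fun i => z (Fin.castAdd n i)) ∈ A ∧
        (fun j => z (Fin.natAdd m j)) ∈ B} ∈ sets (m + n)
  proj_mem : ∀ {n : ℕ} {A : Set (Fin (n + 1) → ℝ)}, A ∈ sets (n + 1) →
    (fun (z : Fin (n + 1) → ℝ) (i : Fin n) => z i.castSucc) '' A ∈ sets n
  algebraic_mem : ∀ {n : ℕ} (p : MvPolynomial (Fin n) ℝ),
    {x : Fin n → ℝ | MvPolynomial.eval x p = 0} ∈ sets n
  /-- The intervals of `ℝ` (open, closed or half-open, bounded or not, points included) are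
  exactly the order-connected subsets of `ℝ`. -/
  mem_one_iff : ∀ S : Set ℝ, {x : Fin 1 → ℝ | x 0 ∈ S} ∈ sets 1 ↔
    ∃ F : Set (Set ℝ), F.Finite ∧ (∀ I ∈ F, I.OrdConnected) ∧ S = ⋃₀ F

/-- The graph of `f : U → ℝⁿ`, `U ⊆ ℝᵐ`, as a subset of `ℝᵐ⁺ⁿ`. The values of `f` outside `U`
play no role. -/
def graphOver {m n : ℕ} (U : Set (EuclideanSpace ℝ (Fin m)))
    (f : EuclideanSpace ℝ (Fin m) → EuclideanSpace ℝ (Fin n)) : Set (Fin (m + n) → ℝ) :=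
  {z | ∃ x ∈ U, z = Fin.append (fun i => x i) (fun j => f x j)}

/-- The mapping `f : U → ℝⁿ` is definable in some o-minimal structure on `(ℝ, +, ·, <)`. -/
def IsDefinableMap {m n : ℕ} (U : Set (EuclideanSpace ℝ (Fin m)))
    (f : EuclideanSpace ℝ (Fin m) → EuclideanSpace ℝ (Fin n)) : Prop :=
  ∃ O : OMinimalStructure, graphOver U f ∈ O.sets (m + n)

/-- `𝒟(f)`: the set of differentials of `f` at the points of `U` (an open set) where `f` is
differentiable. -/
def differentials {m n : ℕ} (U : Set (EuclideanSpace ℝ (Fin m)))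
    (f : EuclideanSpace ℝ (Fin m) → EuclideanSpace ℝ (Fin n)) :
    Set (EuclideanSpace ℝ (Fin m) →L[ℝ] EuclideanSpace ℝ (Fin n)) :=
  {A | ∃ y ∈ U, HasFDerivAt f A y}

/-- `𝒟ᵥ(f) = {A v : A ∈ 𝒟(f)}`. -/
def differentialsAlong {m n : ℕ} (U : Set (EuclideanSpace ℝ (Fin m)))
    (f : EuclideanSpace ℝ (Fin m) → EuclideanSpace ℝ (Fin n))
    (v : EuclideanSpace ℝ (Fin m)) : Set (EuclideanSpace ℝ (Fin n)) :=
  {w | ∃ A ∈ differentials U f, w = A v}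

/-- `Dirᵥ(f)`: the set of the (one-sided) directional derivatives
`∂ᵥf(y) = lim_{h → 0+} (f(y + h v) - f(y)) / h`, over all points `y` of `U` where the limit
exists. -/
def directionalDerivs {m n : ℕ} (U : Set (EuclideanSpace ℝ (Fin m)))
    (f : EuclideanSpace ℝ (Fin m) → EuclideanSpace ℝ (Fin n))
    (v : EuclideanSpace ℝ (Fin m)) : Set (EuclideanSpace ℝ (Fin n)) :=
  {w | ∃ y ∈ U, Tendsto (fun h : ℝ => h⁻¹ • (f (y + h • v) - f y)) (𝓝[>] 0) (𝓝 w)}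

/-! Part (1) carries the weight: a directional derivative at `y` is the right derivative at the left
end of a short segment issuing from `y`, and `df(y) v` is itself a directional derivative.

The axiom on definable subsets of the line is used through tameness: on either side of a point, such
a set is eventually everything or eventually empty. It is applied along lines to the condition that
a coordinate of `f` grows faster than a constant (`GrowsFaster`). With continuity, this turns
pointwise growth conditions into slope bounds on intervals.

Suppose `g'(t₀) = w`. Beside `t₀` the comparisons of the growth rates with `w i ± ε` do not change,
so all slopes of `g` on an interval ending at `t₀` are `ε`-close to `w`
(`exists_interval_slopes_near`). Translate that segment by `s • u` with `u` fixed. For each `t` the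
comparisons with `w i ± 2ε` stabilise as `s → 0+`; Baire category makes this uniform for `t` dense
in a subinterval, tameness in `t` fills the gaps, and letting `s → 0` identifies the outcome
(`exists_subinterval_slopes_near_translate`). A second use of Baire makes the estimate uniform for
`u` in an open set. The translates then fill an open set, in which `f` has a point of
differentiability, and there `df v` is `2ε`-close to `w` in each coordinate
(`exists_differential_near`).

Points of differentiability are dense (`exists_differentiableAt`): by tameness and Baire, every
nonempty open subset of `U` contains a cube on which the slopes along the axes are bounded; `f` is
Lipschitz there and Rademacher's theorem applies. -/

namespace OMinimalStructure

/-! ### Closure of definable predicates under first-order operations -/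

variable (O : OMinimalStructure)

/-- A predicate on `ℝⁿ` is definable if it cuts out a definable set. -/
def Definable {n : ℕ} (P : (Fin n → ℝ) → Prop) : Prop := {z | P z} ∈ O.sets n

variable {O}

namespace Definable

variable {n k : ℕ} {P Q : (Fin n → ℝ) → Prop}

theorem and (hP : O.Definable P) (hQ : O.Definable Q) : O.Definable fun z => P z ∧ Q z :=
  (O.sets n).infClosed hP hQ

theorem not (hP : O.Definable P) : O.Definable fun z => ¬ P z :=
  BooleanSubalgebra.compl_mem hP

theorem imp (hP : O.Definable P) (hQ : O.Definable Q) : O.Definable fun z => P z → Q z := by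
  have := (hP.and hQ.not).not
  simpa only [not_and, not_not] using this

theorem poly_eq_zero (p : MvPolynomial (Fin n) ℝ) :
    O.Definable fun z => MvPolynomial.eval z p = 0 := O.algebraic_mem p

theorem true : O.Definable fun _ : Fin n → ℝ => True := by
  have := poly_eq_zero (O := O) (0 : MvPolynomial (Fin n) ℝ)
  simpa using this

theorem exists_append {P : (Fin (n + k) → ℝ) → Prop} (hP : O.Definable P) :
    O.Definable fun x : Fin n → ℝ => ∃ y : Fin k → ℝ, P (Fin.append x y) := by
  induction k with
  | zero =>
    have e : (fun x : Fin n → ℝ => ∃ y : Fin 0 → ℝ, P (Fin.append x y)) = P := by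
      funext x
      have h : ∀ y : Fin 0 → ℝ, Fin.append x y = x := fun y => by
        rw [Subsingleton.elim y Fin.elim0, Fin.append_elim0]; rfl
      simp [h]
    rw [e]; exact hP
  | succ k ih =>
    have h1 : O.Definable fun z : Fin (n + k) → ℝ => ∃ r : ℝ, P (Fin.snoc z r) := by
      have := O.proj_mem (n := n + k) hP
      refine (congrArg (· ∈ O.sets (n + k)) ?_).mp this
      ext z
      constructor
      · rintro ⟨w, hw, rfl⟩
        refine ⟨w (Fin.last _), ?_⟩
        have : Fin.snoc (fun i : Fin (n + k) => w i.castSucc) (w (Fin.last _)) = w :=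
          Fin.snoc_init_self w
        change P _
        rw [this]
        exact hw
      · rintro ⟨r, hr⟩
        exact ⟨Fin.snoc z r, hr, by funext i; simp⟩
    refine (congrArg O.Definable ?_).mp (ih h1)
    funext x
    refine propext ⟨?_, ?_⟩
    · rintro ⟨y, r, h⟩
      exact ⟨Fin.snoc y r, by rwa [Fin.append_snoc]⟩
    · rintro ⟨y, h⟩
      refine ⟨Fin.init y, y (Fin.last _), ?_⟩
      rw [← Fin.append_snoc, Fin.snoc_init_self]
      exact h

theorem exists_vec {P : (Fin n → ℝ) → (Fin k → ℝ) → Prop}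
    (hP : O.Definable fun z : Fin (n + k) → ℝ =>
      P (fun i => z (Fin.castAdd k i)) (fun j => z (Fin.natAdd n j))) :
    O.Definable fun x => ∃ y, P x y := by
  have := hP.exists_append
  simpa using this

theorem forall_vec {P : (Fin n → ℝ) → (Fin k → ℝ) → Prop}
    (hP : O.Definable fun z : Fin (n + k) → ℝ =>
      P (fun i => z (Fin.castAdd k i)) (fun j => z (Fin.natAdd n j))) :
    O.Definable fun x => ∀ y, P x y := by
  have := (exists_vec (P := fun x y => ¬ P x y) hP.not).not
  simpa only [not_exists, not_not] using this

/-- Preimages of definable sets under polynomial maps are definable. -/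
theorem comp_poly {P : (Fin k → ℝ) → Prop} (hP : O.Definable P)
    (p : Fin k → MvPolynomial (Fin n) ℝ) :
    O.Definable fun x => P fun j => MvPolynomial.eval x (p j) := by
  have h1 : O.Definable fun z : Fin (n + k) → ℝ => P fun j => z (Fin.natAdd n j) := by
    have := O.prod_mem (true (O := O) (n := n)) hP
    simpa [Definable] using this
  have h2 : O.Definable fun z : Fin (n + k) → ℝ =>
      (fun j => z (Fin.natAdd n j)) =
        fun j => MvPolynomial.eval (fun i => z (Fin.castAdd k i)) (p j) := by
    have := poly_eq_zero (O := O) (∑ j : Fin k,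
      (MvPolynomial.X (Fin.natAdd n j) - MvPolynomial.rename (Fin.castAdd k) (p j)) ^ 2)
    refine (congrArg O.Definable ?_).mp this
    funext z
    simp only [map_sum, map_pow, map_sub, MvPolynomial.eval_X, MvPolynomial.eval_rename]
    rw [Finset.sum_eq_zero_iff_of_nonneg (fun _ _ => sq_nonneg _)]
    simp [funext_iff, sub_eq_zero, Function.comp_def]
  have h3 := exists_vec (P := fun (x : Fin n → ℝ) (y : Fin k → ℝ) =>
    P y ∧ y = fun j => MvPolynomial.eval x (p j)) (h1.and h2)
  simpa using h3

/-- The order comes from the algebra: `p > 0` exactly when `p * y ^ 2 = 1` is solvable in `y`. -/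
theorem poly_pos (p : MvPolynomial (Fin n) ℝ) :
    O.Definable fun z => 0 < MvPolynomial.eval z p := by
  have h := poly_eq_zero (O := O)
    (MvPolynomial.rename (Fin.castAdd 1) p * MvPolynomial.X (Fin.natAdd n 0) ^ 2 - 1)
  have h' := exists_vec (P := fun (x : Fin n → ℝ) (y : Fin 1 → ℝ) =>
    MvPolynomial.eval x p * y 0 ^ 2 = 1) (by
      refine (congrArg O.Definable ?_).mp h
      funext z
      simp [MvPolynomial.eval_rename, Function.comp_def, sub_eq_zero])
  refine (congrArg O.Definable ?_).mp h'
  funext x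
  refine propext ⟨?_, fun hx => ⟨fun _ => (√(MvPolynomial.eval x p))⁻¹, ?_⟩⟩
  · rintro ⟨y, hy⟩
    by_contra hx
    nlinarith [sq_nonneg (y 0)]
  · rw [inv_pow, Real.sq_sqrt hx.le]
    exact mul_inv_cancel₀ hx.ne'

end Definable

end OMinimalStructure

/-! ### Tame subsets of the line -/

/-- A subset of the line is tame if on either side of each point it is eventually everything
or eventually empty. -/
def IsTame (S : Set ℝ) : Prop :=
  ∀ t, ((∀ᶠ s in 𝓝[>] t, s ∈ S) ∨ ∀ᶠ s in 𝓝[>] t, s ∉ S) ∧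
    ((∀ᶠ s in 𝓝[<] t, s ∈ S) ∨ ∀ᶠ s in 𝓝[<] t, s ∉ S)

/-- If points of `S` accumulate at `t` from one side, every point close to `t` on that side lies
between two of them. -/
theorem Set.OrdConnected.isTame {S : Set ℝ} (hS : S.OrdConnected) : IsTame S := by
  intro t
  constructor
  · refine or_iff_not_imp_right.mpr fun h2 => ?_
    simp only [not_eventually, not_not] at h2
    obtain ⟨s₀, hs₀, hts₀⟩ := (h2.and_eventually self_mem_nhdsWithin).exists
    filter_upwards [Ioo_mem_nhdsGT hts₀] with s hs
    obtain ⟨s₁, hs₁, hts₁⟩ := (h2.and_eventually (Ioo_mem_nhdsGT hs.1)).exists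
    exact hS.out hs₁ hs₀ ⟨hts₁.2.le, hs.2.le⟩
  · refine or_iff_not_imp_right.mpr fun h2 => ?_
    simp only [not_eventually, not_not] at h2
    obtain ⟨s₀, hs₀, hts₀⟩ := (h2.and_eventually self_mem_nhdsWithin).exists
    filter_upwards [Ioo_mem_nhdsLT hts₀] with s hs
    obtain ⟨s₁, hs₁, hts₁⟩ := (h2.and_eventually (Ioo_mem_nhdsLT hs.2)).exists
    exact hS.out hs₀ hs₁ ⟨hs.1.le, hts₁.1.le⟩

theorem eventually_mem_sUnion_or {F : Set (Set ℝ)} (hF : F.Finite) {l : Filter ℝ}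
    (h : ∀ I ∈ F, (∀ᶠ s in l, s ∈ I) ∨ ∀ᶠ s in l, s ∉ I) :
    (∀ᶠ s in l, s ∈ ⋃₀ F) ∨ ∀ᶠ s in l, s ∉ ⋃₀ F := by
  by_cases h' : ∃ I ∈ F, ∀ᶠ s in l, s ∈ I
  · obtain ⟨I, hI, hs⟩ := h'
    exact Or.inl (hs.mono fun s hs => ⟨I, hI, hs⟩)
  · refine Or.inr ?_
    have : ∀ I ∈ F, ∀ᶠ s in l, s ∉ I := fun I hI => (h I hI).resolve_left fun hs => h' ⟨I, hI, hs⟩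
    rw [← hF.eventually_all] at this
    exact this.mono fun s hs ⟨I, hI, hsI⟩ => hs I hI hsI

/-- The only place where the description of the definable subsets of the line is used. -/
theorem OMinimalStructure.Definable.isTame {O : OMinimalStructure} {P : ℝ → Prop}
    (hP : O.Definable fun z : Fin 1 → ℝ => P (z 0)) : IsTame {s | P s} := by
  obtain ⟨F, hF, hI, e⟩ := (O.mem_one_iff {s | P s}).mp hP
  rw [e]
  exact fun t => ⟨eventually_mem_sUnion_or hF fun I h => ((hI I h).isTame t).1,
    eventually_mem_sUnion_or hF fun I h => ((hI I h).isTame t).2⟩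

/-! ### Growth conditions along lines -/

/-- The `i`-th coordinate of `f` grows from `y` in the direction `e`, to the right, at a rate
eventually larger than `c`. -/
def GrowsFaster {m n : ℕ} (U : Set (EuclideanSpace ℝ (Fin m)))
    (f : EuclideanSpace ℝ (Fin m) → EuclideanSpace ℝ (Fin n))
    (e : EuclideanSpace ℝ (Fin m)) (i : Fin n) (c : ℝ) (y : EuclideanSpace ℝ (Fin m)) : Prop :=
  ∃ δ > 0, ∀ h, 0 < h → h < δ → (y ∈ U ∧ y + h • e ∈ U) ∧ c * h < f (y + h • e) i - f y i

section Slices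

variable {m n : ℕ} {U : Set (EuclideanSpace ℝ (Fin m))}
  {f : EuclideanSpace ℝ (Fin m) → EuclideanSpace ℝ (Fin n)} {O : OMinimalStructure}

/-- The increments of `f` between two points that depend polynomially on parameters. -/
theorem OMinimalStructure.Definable.increment (hO : graphOver U f ∈ O.sets (m + n)) {k : ℕ}
    (p q : Fin m → MvPolynomial (Fin k) ℝ) (r : MvPolynomial (Fin k) ℝ) (i : Fin n)
    {a b : (Fin k → ℝ) → EuclideanSpace ℝ (Fin m)}
    (ha : ∀ z j, a z j = MvPolynomial.eval z (p j))
    (hb : ∀ z j, b z j = MvPolynomial.eval z (q j)) :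
    O.Definable fun z : Fin k → ℝ =>
      (a z ∈ U ∧ b z ∈ U) ∧ MvPolynomial.eval z r < f (b z) i - f (a z) i := by
  have hG : O.Definable fun z => z ∈ graphOver U f := hO
  have key : ∀ (x : EuclideanSpace ℝ (Fin m)) (y : Fin n → ℝ),
      Fin.append (fun j => x j) y ∈ graphOver U f ↔ x ∈ U ∧ y = fun j => f x j := by
    intro x y
    constructor
    · rintro ⟨x', hx', h⟩
      have h1 : x = x' := by
        ext j
        have := congrFun h (Fin.castAdd n j)
        simpa using this
      subst h1
      refine ⟨hx', ?_⟩
      funext j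
      have := congrFun h (Fin.natAdd m j)
      simpa using this
    · rintro ⟨hx, rfl⟩
      exact ⟨x, hx, rfl⟩
  -- Two blocks of `n` extra variables stand for the values of `f` at `a` and `b`; membership in the
  -- graph pins them down, and they are then quantified away.
  have h1 : O.Definable fun z : Fin (k + n + n) → ℝ =>
      Fin.append (fun j => a (fun l => z (Fin.castAdd n (Fin.castAdd n l))) j)
        (fun j => z (Fin.castAdd n (Fin.natAdd k j))) ∈ graphOver U f := by
    refine (congrArg O.Definable ?_).mp (hG.comp_poly (Fin.append
      (fun j => MvPolynomial.rename (fun l => Fin.castAdd n (Fin.castAdd n l)) (p j))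
      (fun j => MvPolynomial.X (Fin.castAdd n (Fin.natAdd k j)))))
    funext z
    congr 1
    funext j
    refine Fin.addCases (fun j => ?_) (fun j => ?_) j <;>
      simp [MvPolynomial.eval_rename, ha, Function.comp_def]
  have h2 : O.Definable fun z : Fin (k + n + n) → ℝ =>
      Fin.append (fun j => b (fun l => z (Fin.castAdd n (Fin.castAdd n l))) j)
        (fun j => z (Fin.natAdd (k + n) j)) ∈ graphOver U f := by
    refine (congrArg O.Definable ?_).mp (hG.comp_poly (Fin.append
      (fun j => MvPolynomial.rename (fun l => Fin.castAdd n (Fin.castAdd n l)) (q j))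
      (fun j => MvPolynomial.X (Fin.natAdd (k + n) j))))
    funext z
    congr 1
    funext j
    refine Fin.addCases (fun j => ?_) (fun j => ?_) j <;>
      simp [MvPolynomial.eval_rename, hb, Function.comp_def]
  have h3 : O.Definable fun z : Fin (k + n + n) → ℝ =>
      MvPolynomial.eval (fun l => z (Fin.castAdd n (Fin.castAdd n l))) r <
        z (Fin.natAdd (k + n) i) - z (Fin.castAdd n (Fin.natAdd k i)) := by
    refine (congrArg O.Definable ?_).mp (Definable.poly_pos
      (MvPolynomial.X (Fin.natAdd (k + n) i) - MvPolynomial.X (Fin.castAdd n (Fin.natAdd k i)) -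
        MvPolynomial.rename (fun l => Fin.castAdd n (Fin.castAdd n l)) r))
    funext z
    simp [MvPolynomial.eval_rename, Function.comp_def, sub_pos]
  have h4 := Definable.exists_vec (P := fun (z : Fin k → ℝ) (y : Fin n → ℝ) =>
      ∃ y' : Fin n → ℝ, (Fin.append (fun j => a z j) y ∈ graphOver U f ∧
        Fin.append (fun j => b z j) y' ∈ graphOver U f) ∧
        MvPolynomial.eval z r < y' i - y i)
    (Definable.exists_vec (P := fun (z : Fin (k + n) → ℝ) (y' : Fin n → ℝ) =>
      (Fin.append (fun j => a (fun l => z (Fin.castAdd n l)) j)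
        (fun j => z (Fin.natAdd k j)) ∈ graphOver U f ∧
        Fin.append (fun j => b (fun l => z (Fin.castAdd n l)) j) y' ∈ graphOver U f) ∧
        MvPolynomial.eval (fun l => z (Fin.castAdd n l)) r < y' i - z (Fin.natAdd k i))
      ((h1.and h2).and h3))
  refine (congrArg O.Definable ?_).mp h4
  funext z
  simp only [key]
  refine propext ⟨?_, ?_⟩
  · rintro ⟨y, y', ⟨⟨hy, rfl⟩, hy', rfl⟩, h⟩
    exact ⟨⟨hy, hy'⟩, h⟩
  · rintro ⟨⟨hy, hy'⟩, h⟩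
    exact ⟨_, _, ⟨⟨hy, rfl⟩, hy', rfl⟩, h⟩

theorem isTame_increment (hdef : IsDefinableMap U f) (e : EuclideanSpace ℝ (Fin m)) (i : Fin n)
    (c : ℝ) (y : EuclideanSpace ℝ (Fin m)) :
    IsTame {h | (y ∈ U ∧ y + h • e ∈ U) ∧ c * h < f (y + h • e) i - f y i} := by
  obtain ⟨O, hO⟩ := hdef
  refine OMinimalStructure.Definable.isTame (O := O) ?_
  have := OMinimalStructure.Definable.increment hO (k := 1)
    (fun j => MvPolynomial.C (y j)) (fun j => MvPolynomial.C (y j) +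
      MvPolynomial.X 0 * MvPolynomial.C (e j)) (MvPolynomial.C c * MvPolynomial.X 0) i
    (a := fun _ => y) (b := fun z => y + z 0 • e) (by simp) (by simp)
  simpa using this

theorem isTame_growsFaster (hdef : IsDefinableMap U f) (e : EuclideanSpace ℝ (Fin m)) (i : Fin n)
    (c : ℝ) (y u : EuclideanSpace ℝ (Fin m)) :
    IsTame {s : ℝ | GrowsFaster U f e i c (y + s • u)} := by
  obtain ⟨O, hO⟩ := hdef
  refine OMinimalStructure.Definable.isTame (O := O) ?_
  -- Coordinates 0, 1, 2 play the roles of `s`, `δ`, `h` in the first-order formula defining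
  -- `GrowsFaster`.
  have h1 := OMinimalStructure.Definable.increment hO (k := 1 + 1 + 1)
    (fun j => MvPolynomial.C (y j) + MvPolynomial.X 0 * MvPolynomial.C (u j))
    (fun j => MvPolynomial.C (y j) + MvPolynomial.X 0 * MvPolynomial.C (u j) +
      MvPolynomial.X 2 * MvPolynomial.C (e j)) (MvPolynomial.C c * MvPolynomial.X 2) i
    (a := fun z => y + z 0 • u) (b := fun z => y + z 0 • u + z 2 • e) (by simp) (by simp)
  have h2 := OMinimalStructure.Definable.poly_pos (O := O) (n := 1 + 1 + 1) (MvPolynomial.X 2)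
  have h3 := OMinimalStructure.Definable.poly_pos (O := O) (n := 1 + 1 + 1)
    (MvPolynomial.X 1 - MvPolynomial.X 2)
  have h4 := OMinimalStructure.Definable.poly_pos (O := O) (n := 1 + 1) (MvPolynomial.X 1)
  simp only [MvPolynomial.eval_X, map_sub, map_mul, MvPolynomial.eval_C, sub_pos] at h1 h2 h3 h4
  have h5 := OMinimalStructure.Definable.forall_vec (P := fun (z : Fin (1 + 1) → ℝ)
    (h : Fin 1 → ℝ) => 0 < h 0 → h 0 < z 1 → ((y + z 0 • u ∈ U ∧ y + z 0 • u + h 0 • e ∈ U) ∧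
      c * h 0 < f (y + z 0 • u + h 0 • e) i - f (y + z 0 • u) i)) (h2.imp (h3.imp h1))
  have h6 := OMinimalStructure.Definable.exists_vec (P := fun (z : Fin 1 → ℝ)
    (d : Fin 1 → ℝ) => 0 < d 0 ∧ ∀ h : Fin 1 → ℝ,
      0 < h 0 → h 0 < d 0 → ((y + z 0 • u ∈ U ∧ y + z 0 • u + h 0 • e ∈ U) ∧
      c * h 0 < f (y + z 0 • u + h 0 • e) i - f (y + z 0 • u) i)) (h4.and h5)
  refine (congrArg O.Definable ?_).mp h6
  funext z
  refine propext ⟨?_, ?_⟩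
  · rintro ⟨d, hd, h⟩
    exact ⟨d 0, hd, fun t => h fun _ => t⟩
  · rintro ⟨d, hd, h⟩
    exact ⟨fun _ => d, hd, fun t => h (t 0)⟩

theorem GrowsFaster.eventually {e : EuclideanSpace ℝ (Fin m)} {i : Fin n} {c : ℝ}
    {y : EuclideanSpace ℝ (Fin m)} (h : GrowsFaster U f e i c y) :
    ∀ᶠ h in 𝓝[>] (0 : ℝ), c * h ≤ f (y + h • e) i - f y i := by
  obtain ⟨δ, hδ, h⟩ := h
  filter_upwards [Ioo_mem_nhdsGT hδ] with t ht using (h t ht.1 ht.2).2.le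

/-- The bare negation gives the reverse inequality only for arbitrarily small `h`; tameness of the
set of good `h` upgrades this to all small `h`. -/
theorem eventually_le_of_not_growsFaster (hdef : IsDefinableMap U f) (hU : IsOpen U)
    {e : EuclideanSpace ℝ (Fin m)} {i : Fin n} {c : ℝ} {y : EuclideanSpace ℝ (Fin m)}
    (hy : y ∈ U) (h : ¬ GrowsFaster U f e i c y) :
    ∀ᶠ h in 𝓝[>] (0 : ℝ), f (y + h • e) i - f y i ≤ c * h := by
  have hin : ∀ᶠ h : ℝ in 𝓝[>] 0, y + h • e ∈ U := by
    have : Tendsto (fun h : ℝ => y + h • e) (𝓝 0) (𝓝 y) := by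
      have : Continuous fun h : ℝ => y + h • e := by fun_prop
      simpa using this.tendsto 0
    exact (this.mono_left nhdsWithin_le_nhds).eventually (hU.mem_nhds hy)
  rcases (isTame_increment hdef e i c y 0).1 with h' | h'
  · refine absurd ?_ h
    obtain ⟨δ, hδ, hs⟩ := mem_nhdsGT_iff_exists_Ioo_subset.mp h'
    exact ⟨δ, hδ, fun t h0 h1 => hs ⟨h0, h1⟩⟩
  · filter_upwards [h', hin] with t ht hU
    by_contra! hlt
    exact ht ⟨⟨hy, hU⟩, hlt⟩

end Slices

/-! ### Baire category and monotonicity criteria -/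

/-- A countable cover of a nonempty open subset of a Baire space has a member that is dense in
some nonempty open subset. -/
theorem exists_isOpen_subset_closure {X ι : Type*} [TopologicalSpace X] [BaireSpace X]
    [Countable ι] {W : Set X} (hW : IsOpen W) (hne : W.Nonempty) {T : ι → Set X}
    (hT : ∀ x ∈ W, ∃ j, x ∈ T j) :
    ∃ j, ∃ V ⊆ W, IsOpen V ∧ V.Nonempty ∧ V ⊆ closure (T j) := by
  have hd := dense_iUnion_interior_of_closed
    -- The index `none` carries the complement of `W`, so that the closed sets cover the whole
    -- space.
    (f := fun j : Option ι => j.elim Wᶜ fun j => closure (T j))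
    (by rintro (_ | j); exacts [hW.isClosed_compl, isClosed_closure])
    (by
      refine eq_univ_of_forall fun x => mem_iUnion.mpr ?_
      by_cases hx : x ∈ W
      · obtain ⟨j, hj⟩ := hT x hx
        exact ⟨some j, subset_closure hj⟩
      · exact ⟨none, hx⟩)
  obtain ⟨x, hxW, hx⟩ := hd.inter_open_nonempty W hW hne
  obtain ⟨j | j, hj⟩ := mem_iUnion.mp hx
  · exact absurd hxW (interior_subset hj)
  · exact ⟨j, W ∩ interior (closure (T j)), inter_subset_left, hW.inter isOpen_interior,
      ⟨x, hxW, hj⟩, inter_subset_right.trans interior_subset⟩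

/-- Continuous induction: the set where `φ a ≤ φ x` is closed and can always be prolonged to the
right. The hypothesis omits `p`, which is reached by a limit. -/
theorem monotoneOn_Icc_of_eventually_le {φ : ℝ → ℝ} {p q : ℝ} (hφ : ContinuousOn φ (Icc p q))
    (h : ∀ t ∈ Ioo p q, ∀ᶠ s in 𝓝[>] (0 : ℝ), φ t ≤ φ (t + s)) : MonotoneOn φ (Icc p q) := by
  have key : ∀ a b, p < a → a ≤ b → b ≤ q → φ a ≤ φ b := by
    intro a b ha hab hb
    have hc : ContinuousOn φ (Icc a b) := hφ.mono (Icc_subset_Icc ha.le hb)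
    have hcl : IsClosed ({x | φ a ≤ φ x} ∩ Icc a b) := by
      have := hc.preimage_isClosed_of_isClosed isClosed_Icc (isClosed_Ici (a := φ a))
      rwa [inter_comm] at this
    refine hcl.Icc_subset_of_forall_exists_gt (le_refl (φ a)) ?_ (right_mem_Icc.mpr hab)
    rintro x ⟨hx, hxab⟩ y hy
    have hy' : 0 < y - x := sub_pos.mpr hy
    obtain ⟨s, hs, hs'⟩ := ((h x ⟨ha.trans_le hxab.1, hxab.2.trans_le hb⟩).and
      (Ioo_mem_nhdsGT hy')).exists
    exact ⟨x + s, le_trans hx hs, by linarith [hs'.1], by linarith [hs'.2]⟩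
  intro a ha b hb hab
  rcases ha.1.lt_or_eq with h' | rfl
  · exact key a b h' hab hb.2
  rcases hab.lt_or_eq with h' | rfl
  · have ht : Tendsto φ (𝓝[Ioo p b] p) (𝓝 (φ p)) :=
      (hφ p ha).mono_left (nhdsWithin_mono _ fun x hx => ⟨hx.1.le, hx.2.le.trans hb.2⟩)
    have : (𝓝[Ioo p b] p).NeBot := by
      rw [nhdsWithin_Ioo_eq_nhdsGT h']; infer_instance
    exact le_of_tendsto ht (by
      filter_upwards [self_mem_nhdsWithin] with x hx using key x b hx.1 hx.2.le hb.2)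
  · exact le_rfl

/-- The growth condition may fail at `t` itself, but monotonicity on a small `[t, r]`, which only
needs it inside, restores it there. -/
theorem monotoneOn_Icc_of_eventually_eventually_le {φ : ℝ → ℝ} {p q : ℝ}
    (hφ : ContinuousOn φ (Icc p q))
    (h : ∀ t ∈ Ioo p q, ∀ᶠ t' in 𝓝[>] t, ∀ᶠ s in 𝓝[>] (0 : ℝ), φ t' ≤ φ (t' + s)) :
    MonotoneOn φ (Icc p q) := by
  refine monotoneOn_Icc_of_eventually_le hφ fun t ht => ?_
  obtain ⟨r, hr, hs⟩ := mem_nhdsGT_iff_exists_Ioo_subset.mp (h t ht)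
  have hlt : t < min r q := lt_min hr ht.2
  have hm := monotoneOn_Icc_of_eventually_le (φ := φ) (p := t) (q := min r q)
    (hφ.mono (Icc_subset_Icc ht.1.le (min_le_right _ _)))
    fun t' ht' => hs ⟨ht'.1, ht'.2.trans_le (min_le_left _ _)⟩
  filter_upwards [Ioo_mem_nhdsGT (sub_pos.mpr hlt)] with s hs
  exact hm (left_mem_Icc.mpr hlt.le) ⟨by linarith [hs.1], by linarith [hs.2]⟩ (by linarith [hs.1])

/-- Density rules out the alternative of being eventually empty. -/
theorem IsTame.eventually_mem_of_subset_closure {S T : Set ℝ} (hS : IsTame S) {p q : ℝ}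
    (hT : Ioo p q ⊆ closure T) (hTS : T ⊆ S) : ∀ t ∈ Ioo p q, ∀ᶠ s in 𝓝[>] t, s ∈ S := by
  intro t ht
  refine (hS t).1.resolve_right fun h => ?_
  obtain ⟨r, hr, hs⟩ := mem_nhdsGT_iff_exists_Ioo_subset.mp h
  obtain ⟨x, hx, hx'⟩ := exists_between (lt_min hr ht.2)
  obtain ⟨y, hy, hyT⟩ := mem_closure_iff.mp (hT ⟨ht.1.trans hx, hx'.trans_le (min_le_right _ _)⟩)
    (Ioo t r) isOpen_Ioo ⟨hx, hx'.trans_le (min_le_left _ _)⟩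
  exact hs hy (hTS hyT)

theorem IsTame.compl {S : Set ℝ} (hS : IsTame S) : IsTame Sᶜ := fun t =>
  ⟨by simpa [or_comm] using (hS t).1, by simpa [or_comm] using (hS t).2⟩

/-! ### From growth conditions to slope inequalities -/

section Slopes

variable {m n : ℕ} {U : Set (EuclideanSpace ℝ (Fin m))}
  {f : EuclideanSpace ℝ (Fin m) → EuclideanSpace ℝ (Fin n)}

theorem continuousOn_line (hf : ContinuousOn f U) {x v : EuclideanSpace ℝ (Fin m)} {p q : ℝ}
    (hx : ∀ t ∈ Icc p q, x + t • v ∈ U) (i : Fin n) :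
    ContinuousOn (fun t : ℝ => f (x + t • v) i) (Icc p q) := by
  have h1 : ContinuousOn (fun t : ℝ => f (x + t • v)) (Icc p q) :=
    hf.comp (by fun_prop) hx
  exact (EuclideanSpace.proj (𝕜 := ℝ) i).continuous.comp_continuousOn h1

theorem slope_ge_of_growsFaster (hf : ContinuousOn f U) {x v : EuclideanSpace ℝ (Fin m)}
    {p q c : ℝ} {i : Fin n} (hx : ∀ t ∈ Icc p q, x + t • v ∈ U)
    (h : ∀ t ∈ Ioo p q, ∀ᶠ s in 𝓝[>] t, GrowsFaster U f v i c (x + s • v)) {t t' : ℝ}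
    (ht : t ∈ Icc p q) (ht' : t' ∈ Icc p q) (htt' : t ≤ t') :
    c * (t' - t) ≤ f (x + t' • v) i - f (x + t • v) i := by
  have hm := monotoneOn_Icc_of_eventually_eventually_le
    (φ := fun t : ℝ => f (x + t • v) i - c * t)
    ((continuousOn_line hf hx i).sub (by fun_prop)) fun t ht => by
      filter_upwards [h t ht] with s hs
      filter_upwards [hs.eventually] with r hr
      rw [add_assoc, ← add_smul] at hr
      linarith
  have := hm ht ht' htt'
  dsimp only at this
  linarith

theorem slope_le_of_not_growsFaster (hU : IsOpen U) (hf : ContinuousOn f U)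
    (hdef : IsDefinableMap U f) {x v : EuclideanSpace ℝ (Fin m)}
    {p q c : ℝ} {i : Fin n} (hx : ∀ t ∈ Icc p q, x + t • v ∈ U)
    (h : ∀ t ∈ Ioo p q, ∀ᶠ s in 𝓝[>] t, ¬ GrowsFaster U f v i c (x + s • v)) {t t' : ℝ}
    (ht : t ∈ Icc p q) (ht' : t' ∈ Icc p q) (htt' : t ≤ t') :
    f (x + t' • v) i - f (x + t • v) i ≤ c * (t' - t) := by
  have hm := monotoneOn_Icc_of_eventually_eventually_le
    (φ := fun t : ℝ => c * t - f (x + t • v) i)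
    (ContinuousOn.sub (by fun_prop) (continuousOn_line hf hx i)) fun t ht => by
      filter_upwards [h t ht, Ioo_mem_nhdsGT ht.2] with s hs hst
      filter_upwards [eventually_le_of_not_growsFaster hdef hU
        (hx s ⟨ht.1.le.trans hst.1.le, hst.2.le⟩) hs] with r hr
      rw [add_assoc, ← add_smul] at hr
      linarith
  have := hm ht ht' htt'
  dsimp only at this
  linarith

end Slopes

/-! ### Open sets with bounded slopes -/

section Differentiability

variable {m n : ℕ} {U : Set (EuclideanSpace ℝ (Fin m))}
  {f : EuclideanSpace ℝ (Fin m) → EuclideanSpace ℝ (Fin n)}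

/-- Otherwise tameness makes `f` grow faster than every `k` just to the right of every point of the
interval, and the mean slope over `[p, q]` would be at least every `k`. -/
theorem exists_subinterval_slope_le (hU : IsOpen U) (hf : ContinuousOn f U)
    (hdef : IsDefinableMap U f) {x v : EuclideanSpace ℝ (Fin m)} {p q : ℝ} (hpq : p < q)
    (hx : ∀ t ∈ Icc p q, x + t • v ∈ U) (i : Fin n) :
    ∃ p' q' : ℝ, p ≤ p' ∧ p' < q' ∧ q' ≤ q ∧ ∃ k : ℕ, ∀ t ∈ Icc p' q', ∀ t' ∈ Icc p' q', t ≤ t' →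
      f (x + t' • v) i - f (x + t • v) i ≤ k * (t' - t) := by
  by_cases h : ∃ k : ℕ, ∃ t ∈ Ioo p q, ∀ᶠ s in 𝓝[>] t, ¬ GrowsFaster U f v i k (x + s • v)
  · obtain ⟨k, t, ht, h⟩ := h
    obtain ⟨r, hr, hs⟩ := mem_nhdsGT_iff_exists_Ioo_subset.mp h
    have hlt : t < min r q := lt_min hr ht.2
    refine ⟨t, min r q, ht.1.le, hlt, min_le_right _ _, k, fun a ha b hb hab =>
      slope_le_of_not_growsFaster hU hf hdef (fun τ hτ => hx τ ?_) (fun τ hτ => ?_) ha hb hab⟩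
    · exact ⟨ht.1.le.trans hτ.1, hτ.2.trans (min_le_right _ _)⟩
    · filter_upwards [Ioo_mem_nhdsGT hτ.2] with s hs'
      exact hs ⟨hτ.1.trans hs'.1, hs'.2.trans_le (min_le_left _ _)⟩
  · push Not at h
    exfalso
    obtain ⟨k, hk⟩ := exists_nat_gt ((f (x + q • v) i - f (x + p • v) i) / (q - p))
    rw [div_lt_iff₀ (sub_pos.mpr hpq)] at hk
    refine hk.not_ge (slope_ge_of_growsFaster hf hx (fun t ht => ?_)
      (left_mem_Icc.mpr hpq.le) (right_mem_Icc.mpr hpq.le) hpq.le)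
    refine ((isTame_growsFaster hdef v i k x v) t).1.resolve_right fun h' => ?_
    obtain ⟨s, hs, hs'⟩ := ((h k t ht).and_eventually h').exists
    exact hs' hs

theorem exists_subinterval_slope_ge (hU : IsOpen U) (hf : ContinuousOn f U)
    (hdef : IsDefinableMap U f) {x v : EuclideanSpace ℝ (Fin m)} {p q : ℝ} (hpq : p < q)
    (hx : ∀ t ∈ Icc p q, x + t • v ∈ U) (i : Fin n) :
    ∃ p' q' : ℝ, p ≤ p' ∧ p' < q' ∧ q' ≤ q ∧ ∃ k : ℕ, ∀ t ∈ Icc p' q', ∀ t' ∈ Icc p' q', t ≤ t' →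
      -k * (t' - t) ≤ f (x + t' • v) i - f (x + t • v) i := by
  by_cases h : ∃ k : ℕ, ∃ t ∈ Ioo p q, ∀ᶠ s in 𝓝[>] t, GrowsFaster U f v i (-k) (x + s • v)
  · obtain ⟨k, t, ht, h⟩ := h
    obtain ⟨r, hr, hs⟩ := mem_nhdsGT_iff_exists_Ioo_subset.mp h
    have hlt : t < min r q := lt_min hr ht.2
    refine ⟨t, min r q, ht.1.le, hlt, min_le_right _ _, k, fun a ha b hb hab =>
      slope_ge_of_growsFaster hf (fun τ hτ => hx τ ?_) (fun τ hτ => ?_) ha hb hab⟩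
    · exact ⟨ht.1.le.trans hτ.1, hτ.2.trans (min_le_right _ _)⟩
    · filter_upwards [Ioo_mem_nhdsGT hτ.2] with s hs'
      exact hs ⟨hτ.1.trans hs'.1, hs'.2.trans_le (min_le_left _ _)⟩
  · push Not at h
    exfalso
    obtain ⟨k, hk⟩ := exists_nat_gt (-(f (x + q • v) i - f (x + p • v) i) / (q - p))
    rw [div_lt_iff₀ (sub_pos.mpr hpq)] at hk
    have := slope_le_of_not_growsFaster (c := -k) (i := i) hU hf hdef hx (fun t ht => ?_)
      (left_mem_Icc.mpr hpq.le) (right_mem_Icc.mpr hpq.le) hpq.le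
    · linarith
    refine ((isTame_growsFaster hdef v i (-k) x v) t).1.resolve_left fun h' => ?_
    obtain ⟨s, hs, hs'⟩ := ((h k t ht).and_eventually h').exists
    exact hs hs'

/-- Every interval has a subinterval with rational end points on which the slopes of `f` in the
direction `v` are bounded. -/
theorem exists_subinterval_abs_slope_le (hU : IsOpen U) (hf : ContinuousOn f U)
    (hdef : IsDefinableMap U f) {x v : EuclideanSpace ℝ (Fin m)} {p q : ℝ} (hpq : p < q)
    (hx : ∀ t ∈ Icc p q, x + t • v ∈ U) (i : Fin n) :
    ∃ p' q' : ℚ, p ≤ p' ∧ p' < q' ∧ q' ≤ q ∧ ∃ k : ℕ,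
      ∀ t ∈ Icc (p' : ℝ) q', ∀ t' ∈ Icc (p' : ℝ) q', t ≤ t' →
        |f (x + t' • v) i - f (x + t • v) i| ≤ k * (t' - t) := by
  obtain ⟨p₁, q₁, hp₁, hpq₁, hq₁, k₁, h₁⟩ := exists_subinterval_slope_le hU hf hdef hpq hx i
  obtain ⟨p₂, q₂, hp₂, hpq₂, hq₂, k₂, h₂⟩ := exists_subinterval_slope_ge hU hf hdef hpq₁
    (fun t ht => hx t ⟨hp₁.trans ht.1, ht.2.trans hq₁⟩) i
  obtain ⟨r, hr, hr'⟩ := exists_rat_btwn hpq₂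
  obtain ⟨r', hr₁, hr₂⟩ := exists_rat_btwn hr'
  refine ⟨r, r', by linarith, by exact_mod_cast hr₁, by linarith, max k₁ k₂,
    fun t ht t' ht' htt' => ?_⟩
  have e₁ := h₁ t ⟨by linarith [ht.1], by linarith [ht.2]⟩ t'
    ⟨by linarith [ht'.1], by linarith [ht'.2]⟩ htt'
  have e₂ := h₂ t ⟨by linarith [ht.1], by linarith [ht.2]⟩ t'
    ⟨by linarith [ht'.1], by linarith [ht'.2]⟩ htt'
  have hm₁ : (k₁ : ℝ) ≤ (max k₁ k₂ : ℕ) := by exact_mod_cast le_max_left _ _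
  have hm₂ : (k₂ : ℝ) ≤ (max k₁ k₂ : ℕ) := by exact_mod_cast le_max_right _ _
  have ht0 : 0 ≤ t' - t := sub_nonneg.mpr htt'
  have m₁ := mul_le_mul_of_nonneg_right hm₁ ht0
  have m₂ := mul_le_mul_of_nonneg_right hm₂ ht0
  rw [abs_le]
  constructor <;> linarith

/-- Each point `y` has a rational interval of parameters and an integer bound for the slopes along
`y + t • v`. There are countably many such data, so by Baire one choice serves a dense subset of an
open set `W`, and by continuity all of `W`. Translating `W` along `v` into that interval gives the
required set. -/
theorem exists_isOpen_slope_bounded (hU : IsOpen U) (hf : ContinuousOn f U)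
    (hdef : IsDefinableMap U f) (v : EuclideanSpace ℝ (Fin m)) (i : Fin n)
    {V : Set (EuclideanSpace ℝ (Fin m))} (hV : IsOpen V) (hne : V.Nonempty) (hVU : V ⊆ U) :
    ∃ V' ⊆ V, IsOpen V' ∧ V'.Nonempty ∧ ∃ K : ℝ, ∀ y ∈ V', ∀ h : ℝ, 0 ≤ h → y + h • v ∈ V' →
      |f (y + h • v) i - f y i| ≤ K * h := by
  obtain ⟨c, hc⟩ := hne
  obtain ⟨ρ, hρ, hρV⟩ := Metric.nhds_basis_closedBall.mem_iff.mp (hV.mem_nhds hc)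
  obtain ⟨⟨p, q, k⟩, W, hWB, hW, hWne, hWT⟩ := exists_isOpen_subset_closure
    (ι := ℚ × ℚ × ℕ) (W := Metric.ball c ρ) Metric.isOpen_ball ⟨c, Metric.mem_ball_self hρ⟩
    (T := fun j => {y | j.1 < j.2.1 ∧ (∀ t ∈ Icc (j.1 : ℝ) j.2.1, y + t • v ∈ Metric.ball c ρ) ∧
      ∀ t ∈ Icc (j.1 : ℝ) j.2.1, ∀ t' ∈ Icc (j.1 : ℝ) j.2.1, t ≤ t' →
        |f (y + t' • v) i - f (y + t • v) i| ≤ j.2.2 * (t' - t)}) (by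
    intro y hy
    have hcont : Tendsto (fun t : ℝ => y + t • v) (𝓝 0) (𝓝 y) := by
      have : Continuous fun t : ℝ => y + t • v := by fun_prop
      simpa using this.tendsto 0
    obtain ⟨δ, hδ, hδ'⟩ := Metric.nhds_basis_closedBall.mem_iff.mp
      (hcont (Metric.isOpen_ball.mem_nhds hy))
    have hB : ∀ t ∈ Icc 0 δ, y + t • v ∈ Metric.ball c ρ := fun t ht => hδ' (by
      rw [mem_closedBall_zero_iff, Real.norm_eq_abs, abs_of_nonneg ht.1]; exact ht.2)
    obtain ⟨p, q, hp, hpq, hq, k, h⟩ := exists_subinterval_abs_slope_le hU hf hdef hδ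
      (fun t ht => hVU (hρV (Metric.ball_subset_closedBall (hB t ht)))) i
    exact ⟨(p, q, k), hpq, fun t ht => hB t ⟨hp.trans ht.1, ht.2.trans hq⟩, h⟩)
  obtain ⟨w, hw⟩ := hWne
  obtain ⟨y₀, hy₀W, hpq, hy₀B, -⟩ := mem_closure_iff.mp (hWT hw) W hW hw
  dsimp only at hpq hy₀B hWT
  have hpq' : (p : ℝ) < q := by exact_mod_cast hpq
  -- Points of `W` are only limits of good points; this is why the closed ball was chosen inside
  -- `V`.
  have hWU : ∀ y ∈ W, ∀ t ∈ Icc (p : ℝ) q, y + t • v ∈ U := by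
    intro y hy t ht
    refine hVU (hρV ?_)
    have : y + t • v ∈ closure (Metric.ball c ρ) := by
      refine map_mem_closure (f := fun y => y + t • v) (by fun_prop) (hWT hy) ?_
      rintro z ⟨-, hz, -⟩
      exact hz t ht
    exact Metric.closure_ball_subset_closedBall this
  have hWs : ∀ y ∈ W, ∀ t ∈ Icc (p : ℝ) q, ∀ t' ∈ Icc (p : ℝ) q, t ≤ t' →
      |f (y + t' • v) i - f (y + t • v) i| ≤ k * (t' - t) := by
    intro y hy t ht t' ht' htt'
    have hct : ∀ t ∈ Icc (p : ℝ) q, ContinuousAt (fun z => f (z + t • v) i) y := by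
      intro t ht
      have h1 : ContinuousAt f (y + t • v) := hf.continuousAt (hU.mem_nhds (hWU y hy t ht))
      have h2 : ContinuousAt (fun z => f (z + t • v)) y :=
        ContinuousAt.comp (f := fun z => z + t • v) h1 (by fun_prop)
      exact (EuclideanSpace.proj (𝕜 := ℝ) i).continuous.continuousAt.comp h2
    have hc := ((hct t' ht').sub (hct t ht)).abs
    by_contra! hlt
    obtain ⟨z, hz, -, -, hz'⟩ := mem_closure_iff_nhds.mp (hWT hy) _
      (hc.eventually (lt_mem_nhds hlt))
    exact (hz' t ht t' ht' htt').not_gt hz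
  obtain ⟨σ, hσ, hσW⟩ := Metric.isOpen_iff.mp hW y₀ hy₀W
  set τ : ℝ := (p + q) / 2 with hτ
  have hz₀ : y₀ + τ • v ∈ Metric.ball c ρ := hy₀B τ ⟨by linarith, by linarith⟩
  by_cases hv : v = 0
  · subst hv
    exact ⟨V, subset_rfl, hV, ⟨c, hc⟩, 0, fun y _ h _ _ => by simp⟩
  have hv' : 0 < ‖v‖ := norm_pos_iff.mpr hv
  -- The bound `σ` keeps `y - τ • v` in `W`; the other bound forces `h < (q - p) / 2`, so that `τ +
  -- h` stays in `[p, q]`, `τ` being the midpoint.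
  set η := min σ ((q - p) / 4 * ‖v‖) with hη
  have hη0 : 0 < η := lt_min hσ (by have : 0 < (q : ℝ) - p := by linarith
                                    positivity)
  refine ⟨Metric.ball c ρ ∩ Metric.ball (y₀ + τ • v) η,
    inter_subset_left.trans (Metric.ball_subset_closedBall.trans hρV),
    Metric.isOpen_ball.inter Metric.isOpen_ball, ⟨_, hz₀, Metric.mem_ball_self hη0⟩, k, ?_⟩
  rintro y ⟨-, hy⟩ h hh ⟨-, hyh⟩
  have hyW : y - τ • v ∈ W := hσW (by
    rw [Metric.mem_ball, dist_eq_norm] at hy ⊢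
    rw [show y - τ • v - y₀ = y - (y₀ + τ • v) by abel]
    exact hy.trans_le (min_le_left _ _))
  have hhv : h * ‖v‖ < 2 * η := by
    have h1 : ‖h • v‖ < 2 * η := by
      rw [Metric.mem_ball, dist_eq_norm] at hy hyh
      calc ‖h • v‖ = ‖(y + h • v - (y₀ + τ • v)) - (y - (y₀ + τ • v))‖ := by congr 1; abel
        _ ≤ _ := norm_sub_le _ _
        _ < 2 * η := by linarith
    rwa [norm_smul, Real.norm_eq_abs, abs_of_nonneg hh] at h1
  have hlt : h < (q - p) / 2 := by
    have : h * ‖v‖ < (q - p) / 2 * ‖v‖ := by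
      have := min_le_right σ ((q - p) / 4 * ‖v‖)
      linarith
    exact lt_of_mul_lt_mul_right this hv'.le
  have := hWs _ hyW τ ⟨by linarith, by linarith⟩ (τ + h) ⟨by linarith, by linarith⟩ (by linarith)
  rw [show y - τ • v + (τ + h) • v = y + h • v by rw [add_smul]; abel, sub_add_cancel,
    add_sub_cancel_left] at this
  exact this

theorem exists_isOpen_slopes_bounded (hU : IsOpen U) (hf : ContinuousOn f U)
    (hdef : IsDefinableMap U f) (S : Finset (Fin m × Fin n))
    {V : Set (EuclideanSpace ℝ (Fin m))} (hV : IsOpen V) (hne : V.Nonempty) (hVU : V ⊆ U) :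
    ∃ V' ⊆ V, IsOpen V' ∧ V'.Nonempty ∧ ∃ K : ℝ, ∀ s ∈ S, ∀ y ∈ V', ∀ h : ℝ, 0 ≤ h →
      y + h • EuclideanSpace.single s.1 1 ∈ V' →
      |f (y + h • EuclideanSpace.single s.1 1) s.2 - f y s.2| ≤ K * h := by
  classical
  induction S using Finset.induction_on with
  | empty => exact ⟨V, subset_rfl, hV, hne, 0, by simp⟩
  | insert s S _ ih =>
    obtain ⟨V₁, hV₁, ho₁, hn₁, K₁, h₁⟩ := ih
    obtain ⟨V₂, hV₂, ho₂, hn₂, K₂, h₂⟩ := exists_isOpen_slope_bounded hU hf hdef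
      (EuclideanSpace.single s.1 1) s.2 ho₁ hn₁ (hV₁.trans hVU)
    refine ⟨V₂, hV₂.trans hV₁, ho₂, hn₂, max K₁ K₂, ?_⟩
    intro s' hs' y hy h hh hyh
    rcases Finset.mem_insert.mp hs' with rfl | hs'
    · exact (h₂ y hy h hh hyh).trans (mul_le_mul_of_nonneg_right (le_max_right _ _) hh)
    · exact (h₁ s' hs' y (hV₂ hy) h hh (hV₂ hyh)).trans
        (mul_le_mul_of_nonneg_right (le_max_left _ _) hh)

end Differentiability

/-! ### Density of the points of differentiability -/

section Rademacher

variable {m n : ℕ} {U : Set (EuclideanSpace ℝ (Fin m))}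
  {f : EuclideanSpace ℝ (Fin m) → EuclideanSpace ℝ (Fin n)}

/-- On a cube, a function with bounded slopes along the coordinate axes is Lipschitz. -/
theorem abs_sub_le_of_slopes_bounded {g : EuclideanSpace ℝ (Fin m) → ℝ} {K r : ℝ}
    {c : EuclideanSpace ℝ (Fin m)}
    (hK : ∀ j y, (∀ l, |y l - c l| < r) → ∀ h : ℝ, 0 ≤ h →
      (∀ l, |(y + h • EuclideanSpace.single j (1 : ℝ)) l - c l| < r) →
      |g (y + h • EuclideanSpace.single j (1 : ℝ)) - g y| ≤ K * h)
    {y z : EuclideanSpace ℝ (Fin m)} (hy : ∀ l, |y l - c l| < r) (hz : ∀ l, |z l - c l| < r) :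
    |g z - g y| ≤ ∑ j, K * |z j - y j| := by
  classical
  -- Path from `y` to `z` changing one coordinate at a time; its vertices stay in the cube.
  let w : Finset (Fin m) → EuclideanSpace ℝ (Fin m) := fun S =>
    WithLp.toLp 2 fun l => if l ∈ S then z l else y l
  have hwl : ∀ S l, w S l = if l ∈ S then z l else y l := fun S l => rfl
  have hw : ∀ S l, |w S l - c l| < r := by
    intro S l
    rw [hwl]
    split_ifs
    exacts [hz l, hy l]
  have key : ∀ S : Finset (Fin m), |g (w S) - g y| ≤ ∑ j ∈ S, K * |z j - y j| := by
    intro S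
    induction S using Finset.induction_on with
    | empty =>
      have : w ∅ = y := by ext l; simp [hwl]
      simp [this]
    | insert j S hj ih =>
      rw [Finset.sum_insert hj]
      have hstep : |g (w (insert j S)) - g (w S)| ≤ K * |z j - y j| := by
        rcases le_total (y j) (z j) with h | h
        · have e : w (insert j S) = w S + (z j - y j) • EuclideanSpace.single j (1 : ℝ) := by
            ext l
            by_cases hl : l = j
            · subst hl; simp [hwl, hj]
            · simp [hwl, hl]
          have := hK j (w S) (hw S) (z j - y j) (sub_nonneg.mpr h) (by rw [← e]; exact hw _)
          rwa [← e, ← abs_of_nonneg (sub_nonneg.mpr h)] at this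
        · have e : w S = w (insert j S) + (y j - z j) • EuclideanSpace.single j (1 : ℝ) := by
            ext l
            by_cases hl : l = j
            · subst hl; simp [hwl, hj]
            · simp [hwl, hl]
          have := hK j (w (insert j S)) (hw _) (y j - z j) (sub_nonneg.mpr h)
            (by rw [← e]; exact hw _)
          rw [← e] at this
          rwa [abs_sub_comm, abs_sub_comm (z j), abs_of_nonneg (sub_nonneg.mpr h)]
      calc |g (w (insert j S)) - g y|
          ≤ |g (w (insert j S)) - g (w S)| + |g (w S) - g y| := abs_sub_le _ _ _
        _ ≤ _ := add_le_add hstep ih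
  have hu : w Finset.univ = z := by ext l; simp [hwl]
  simpa [hu] using key Finset.univ

/-- A continuous definable map is differentiable on a dense set. -/
theorem exists_differentiableAt (hU : IsOpen U) (hf : ContinuousOn f U)
    (hdef : IsDefinableMap U f) {V : Set (EuclideanSpace ℝ (Fin m))} (hV : IsOpen V)
    (hne : V.Nonempty) (hVU : V ⊆ U) : ∃ y ∈ V, DifferentiableAt ℝ f y := by
  obtain ⟨V', hV'V, hV', ⟨c, hc⟩, K, hK⟩ := exists_isOpen_slopes_bounded hU hf hdef
    Finset.univ hV hne hVU
  obtain ⟨r, hr, hrV⟩ : ∃ r > 0, ∀ y : EuclideanSpace ℝ (Fin m),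
      (∀ l, |y l - c l| < r) → y ∈ V' := by
    have h1 : (WithLp.toLp 2 : (Fin m → ℝ) → EuclideanSpace ℝ (Fin m)) ⁻¹' V' ∈
        𝓝 (fun l => c l) :=
      (PiLp.continuous_toLp 2 _).continuousAt.preimage_mem_nhds (hV'.mem_nhds hc)
    obtain ⟨r, hr, hs⟩ := Metric.mem_nhds_iff.mp h1
    refine ⟨r, hr, fun y hy => ?_⟩
    have : (fun l => y l) ∈ Metric.ball (fun l => c l) r :=
      (dist_pi_lt_iff hr).mpr hy
    exact hs this
  set Q : Set (EuclideanSpace ℝ (Fin m)) := {y | ∀ l, |y l - c l| < r} with hQ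
  have hQo : IsOpen Q := by
    rw [hQ, Set.ofPred_forall]
    exact isOpen_iInter_of_finite fun l => isOpen_lt (by fun_prop) continuous_const
  have hcQ : c ∈ Q := fun l => by simpa using hr
  have hlip : ∀ i : Fin n, LipschitzOnWith (Real.toNNReal (m * |K|)) (fun y => f y i) Q := by
    intro i
    refine LipschitzOnWith.of_dist_le_mul fun z hz y hy => ?_
    rw [Real.coe_toNNReal _ (by positivity), Real.dist_eq]
    refine (abs_sub_le_of_slopes_bounded (g := fun y => f y i) (K := K)
      (fun j y hy h hh hyh => hK (j, i) (Finset.mem_univ _) y (hrV y hy) h hh (hrV _ hyh))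
      hy hz).trans ?_
    calc ∑ j, K * |z j - y j| ≤ ∑ _j : Fin m, |K| * dist z y := by
          refine Finset.sum_le_sum fun j _ => ?_
          refine mul_le_mul (le_abs_self K) ?_ (abs_nonneg _) (abs_nonneg _)
          rw [dist_eq_norm]
          simpa using PiLp.norm_apply_le (z - y) j
      _ = m * |K| * dist z y := by simp [mul_assoc]
  -- Rademacher's theorem, for each coordinate; the open cube has positive measure, so some point of
  -- it is good for all coordinates.
  have hae : ∀ᵐ y ∂(MeasureTheory.volume : MeasureTheory.Measure (EuclideanSpace ℝ (Fin m))),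
      ∀ i : Fin n, y ∈ Q → DifferentiableWithinAt ℝ (fun y => f y i) Q y :=
    MeasureTheory.ae_all_iff.mpr fun i => (hlip i).ae_differentiableWithinAt_of_mem
  obtain ⟨y, hyQ, hy⟩ := ((MeasureTheory.frequently_ae_mem_iff.mpr
    (hQo.measure_pos MeasureTheory.volume ⟨c, hcQ⟩).ne').and_eventually hae).exists
  refine ⟨y, hV'V (hrV y hyQ), (differentiableAt_euclidean).mpr fun i => ?_⟩
  exact (hy i hyQ).differentiableAt (hQo.mem_nhds hyQ)

end Rademacher

/-! ### Slopes close to `w` on a segment and on its translates -/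

section Approximation

variable {m n : ℕ} {U : Set (EuclideanSpace ℝ (Fin m))}
  {f : EuclideanSpace ℝ (Fin m) → EuclideanSpace ℝ (Fin n)}

/-- If `f` has derivative `w` at one point of a segment on which the growth rates of all
coordinates compare uniformly with `w ± ε`, then all slopes on the segment are `ε`-close to `w`. -/
theorem slopes_near_of_hasDerivWithinAt (hU : IsOpen U) (hf : ContinuousOn f U)
    (hdef : IsDefinableMap U f) {x v : EuclideanSpace ℝ (Fin m)} {p q : ℝ} (hpq : p < q)
    (hx : ∀ t ∈ Icc p q, x + t • v ∈ U) {w : EuclideanSpace ℝ (Fin n)} {t₀ : ℝ}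
    (ht₀ : t₀ ∈ Icc p q) (hw : HasDerivWithinAt (fun s : ℝ => f (x + s • v)) w (Icc p q) t₀)
    {ε : ℝ} (hε : 0 < ε)
    (hpat : ∀ (i : Fin n) (b : Bool),
      (∀ s ∈ Ioo p q, GrowsFaster U f v i (w i + b.rec (-ε) ε) (x + s • v)) ∨
      ∀ s ∈ Ioo p q, ¬ GrowsFaster U f v i (w i + b.rec (-ε) ε) (x + s • v)) :
    ∀ i, ∀ t ∈ Icc p q, ∀ t' ∈ Icc p q, t ≤ t' →
      |f (x + t' • v) i - f (x + t • v) i - w i * (t' - t)| ≤ ε * (t' - t) := by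
  intro i
  have hev : ∀ {P : ℝ → Prop}, (∀ s ∈ Ioo p q, P s) → ∀ t ∈ Ioo p q, ∀ᶠ s in 𝓝[>] t, P s := by
    intro P hP t ht
    filter_upwards [Ioo_mem_nhdsGT ht.2] with s hs using hP s ⟨ht.1.trans hs.1, hs.2⟩
  have hd : HasDerivWithinAt (fun s : ℝ => f (x + s • v) i) (w i) (Icc p q) t₀ :=
    ((EuclideanSpace.proj (𝕜 := ℝ) i).hasFDerivAt.comp_hasDerivWithinAt t₀ hw)
  have hud := uniqueDiffOn_Icc hpq t₀ ht₀
  have hge : ∀ c, (∀ s ∈ Ioo p q, GrowsFaster U f v i c (x + s • v)) → c ≤ w i := by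
    intro c hc
    have hm : MonotoneOn (fun s : ℝ => f (x + s • v) i - c * s) (Icc p q) := by
      intro a ha b hb hab
      have := slope_ge_of_growsFaster hf hx (hev hc) ha hb hab
      dsimp only
      linarith
    have h1 := hm.derivWithin_nonneg (x := t₀)
    have h2 : HasDerivWithinAt (fun s : ℝ => f (x + s • v) i - c * s) (w i - c * 1) (Icc p q) t₀ :=
      hd.sub ((hasDerivWithinAt_id t₀ (Icc p q)).const_mul c)
    rw [h2.derivWithin hud] at h1
    linarith
  have hle : ∀ c, (∀ s ∈ Ioo p q, ¬ GrowsFaster U f v i c (x + s • v)) → w i ≤ c := by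
    intro c hc
    have hm : MonotoneOn (fun s : ℝ => c * s - f (x + s • v) i) (Icc p q) := by
      intro a ha b hb hab
      have := slope_le_of_not_growsFaster hU hf hdef hx (hev hc) ha hb hab
      dsimp only
      linarith
    have h1 := hm.derivWithin_nonneg (x := t₀)
    have h2 : HasDerivWithinAt (fun s : ℝ => c * s - f (x + s • v) i) (c * 1 - w i) (Icc p q) t₀ :=
      ((hasDerivWithinAt_id t₀ (Icc p q)).const_mul c).sub hd
    rw [h2.derivWithin hud] at h1
    linarith
  -- `true` stands for `w i + ε` and `false` for `w i - ε`. Growth faster than `w i + ε` all along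
  -- the segment would force the derivative at `t₀` to be at least that.
  have hup := (hpat i true).resolve_left fun h => by
    have := hge _ h
    dsimp only at this
    linarith
  have hlo := (hpat i false).resolve_right fun h => by
    have := hle _ h
    dsimp only at this
    linarith
  intro t ht t' ht' htt'
  have h1 := slope_le_of_not_growsFaster hU hf hdef hx (hev hup) ht ht' htt'
  have h2 := slope_ge_of_growsFaster hf hx (hev hlo) ht ht' htt'
  dsimp only at h1 h2
  rw [abs_le]
  constructor <;> linarith

/-- Finitely many tame conditions are involved, so all are constant on a common one-sided
neighbourhood of `t₀`: to the right, unless `t₀ = b`. -/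
theorem exists_interval_slopes_near (hU : IsOpen U) (hf : ContinuousOn f U)
    (hdef : IsDefinableMap U f) {x v : EuclideanSpace ℝ (Fin m)} {a b : ℝ} (hab : a < b)
    (hx : ∀ t ∈ Icc a b, x + t • v ∈ U) {w : EuclideanSpace ℝ (Fin n)} {t₀ : ℝ}
    (ht₀ : t₀ ∈ Icc a b) (hw : HasDerivWithinAt (fun s : ℝ => f (x + s • v)) w (Icc a b) t₀)
    {ε : ℝ} (hε : 0 < ε) :
    ∃ p q, a ≤ p ∧ p < q ∧ q ≤ b ∧ ∀ i, ∀ t ∈ Icc p q, ∀ t' ∈ Icc p q, t ≤ t' →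
      |f (x + t' • v) i - f (x + t • v) i - w i * (t' - t)| ≤ ε * (t' - t) := by
  suffices h : ∃ p q, a ≤ p ∧ p < q ∧ q ≤ b ∧ t₀ ∈ Icc p q ∧ ∀ (i : Fin n) (b : Bool),
      (∀ s ∈ Ioo p q, GrowsFaster U f v i (w i + b.rec (-ε) ε) (x + s • v)) ∨
      ∀ s ∈ Ioo p q, ¬ GrowsFaster U f v i (w i + b.rec (-ε) ε) (x + s • v) by
    obtain ⟨p, q, hp, hpq, hq, ht, hpat⟩ := h
    exact ⟨p, q, hp, hpq, hq, slopes_near_of_hasDerivWithinAt hU hf hdef hpq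
      (fun t ht => hx t ⟨hp.trans ht.1, ht.2.trans hq⟩) ht
      (hw.mono (Icc_subset_Icc hp hq)) hε hpat⟩
  have hpat : ∀ (l : Filter ℝ), (∀ (i : Fin n) (c : ℝ),
      (∀ᶠ s in l, GrowsFaster U f v i c (x + s • v)) ∨
      ∀ᶠ s in l, ¬ GrowsFaster U f v i c (x + s • v)) →
      ∃ S ∈ l, ∀ (i : Fin n) (b : Bool),
      (∀ s ∈ S, GrowsFaster U f v i (w i + b.rec (-ε) ε) (x + s • v)) ∨
      ∀ s ∈ S, ¬ GrowsFaster U f v i (w i + b.rec (-ε) ε) (x + s • v) := by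
    intro l hl
    have h1 : ∀ ib : Fin n × Bool, ∃ S ∈ l,
        (∀ s ∈ S, GrowsFaster U f v ib.1 (w ib.1 + ib.2.rec (-ε) ε) (x + s • v)) ∨
        ∀ s ∈ S, ¬ GrowsFaster U f v ib.1 (w ib.1 + ib.2.rec (-ε) ε) (x + s • v) := by
      rintro ⟨i, b⟩
      rcases hl i (w i + b.rec (-ε) ε) with h | h
      · exact ⟨_, h, Or.inl fun s hs => hs⟩
      · exact ⟨_, h, Or.inr fun s hs => hs⟩
    choose S hS hS' using h1
    refine ⟨⋂ ib, S ib, iInter_mem.mpr hS, fun i b => ?_⟩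
    rcases hS' (i, b) with h | h
    · exact Or.inl fun s hs => h s (mem_iInter.mp hs _)
    · exact Or.inr fun s hs => h s (mem_iInter.mp hs _)
  rcases ht₀.2.lt_or_eq with h | h
  · obtain ⟨S, hS, hS'⟩ := hpat (𝓝[>] t₀) fun i c => (isTame_growsFaster hdef v i c x v t₀).1
    obtain ⟨r, hr, hrS⟩ := mem_nhdsGT_iff_exists_Ioo_subset.mp hS
    have hlt : t₀ < min r b := lt_min hr h
    refine ⟨t₀, min r b, ht₀.1, hlt, min_le_right _ _, left_mem_Icc.mpr hlt.le, fun i b' => ?_⟩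
    have hsub : Ioo t₀ (min r b) ⊆ S :=
      fun s hs => hrS ⟨hs.1, hs.2.trans_le (min_le_left _ _)⟩
    exact (hS' i b').imp (fun h s hs => h s (hsub hs)) (fun h s hs => h s (hsub hs))
  · obtain ⟨S, hS, hS'⟩ := hpat (𝓝[<] t₀) fun i c => (isTame_growsFaster hdef v i c x v t₀).2
    obtain ⟨r, hr, hrS⟩ := mem_nhdsLT_iff_exists_Ioo_subset.mp hS
    have hlt : max r a < t₀ := max_lt hr (h ▸ hab)
    refine ⟨max r a, t₀, le_max_right _ _, hlt, ht₀.2, right_mem_Icc.mpr hlt.le, fun i b' => ?_⟩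
    have hsub : Ioo (max r a) t₀ ⊆ S :=
      fun s hs => hrS ⟨(le_max_left _ _).trans_lt hs.1, hs.2⟩
    exact (hS' i b').imp (fun h s hs => h s (hsub hs)) (fun h s hs => h s (hsub hs))

/-- The closeness of slopes to `w` persists, on a subinterval, along small translations of the
segment in a fixed direction `u`. -/
theorem exists_subinterval_slopes_near_translate (hU : IsOpen U) (hf : ContinuousOn f U)
    (hdef : IsDefinableMap U f) {x v u : EuclideanSpace ℝ (Fin m)} {p q : ℝ} (hpq : p < q)
    (hx : ∀ t ∈ Icc p q, x + t • v ∈ U) {r : ℝ} (hr : 0 < r)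
    (hxu : ∀ s : ℝ, 0 < s → s < r → ∀ t ∈ Icc p q, x + s • u + t • v ∈ U)
    {w : EuclideanSpace ℝ (Fin n)} {ε : ℝ} (hε : 0 < ε)
    (hs : ∀ i, ∀ t ∈ Icc p q, ∀ t' ∈ Icc p q, t ≤ t' →
      |f (x + t' • v) i - f (x + t • v) i - w i * (t' - t)| ≤ ε * (t' - t)) :
    ∃ (p' q' : ℚ) (k : ℕ), p' < q' ∧ p ≤ p' ∧ q' ≤ q ∧
      ∀ s : ℝ, 0 < s → s < r → s < 1 / ((k : ℝ) + 1) → ∀ i, ∀ t ∈ Icc (p' : ℝ) q',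
        ∀ t' ∈ Icc (p' : ℝ) q', t ≤ t' →
        |f (x + s • u + t' • v) i - f (x + s • u + t • v) i - w i * (t' - t)| ≤
          2 * ε * (t' - t) := by
  -- The thresholds are at distance `2 * ε`, while the slopes on the original segment are `ε`-close
  -- to `w`: the gap decides every comparison in the limit `s → 0`.
  set C : Fin n × Bool → ℝ := fun ib => w ib.1 + ib.2.rec (-(2 * ε)) (2 * ε) with hC
  -- Baire over a countable index: `k` measures how small `s` must be, `σ` records the outcomes of
  -- the finitely many comparisons.
  obtain ⟨⟨k, σ⟩, V, hVpq, hVo, ⟨t₀, ht₀⟩, hVT⟩ := exists_isOpen_subset_closure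
    (ι := ℕ × (Fin n × Bool → Prop)) (W := Ioo p q) isOpen_Ioo (nonempty_Ioo.mpr hpq)
    (T := fun j => {t | ∀ s : ℝ, 0 < s → s < 1 / ((j.1 : ℝ) + 1) → ∀ ib : Fin n × Bool,
      (GrowsFaster U f v ib.1 (C ib) (x + s • u + t • v) ↔ j.2 ib)}) (by
    intro t ht
    have h1 : ∀ᶠ s : ℝ in 𝓝[>] 0, ∀ ib : Fin n × Bool,
        (GrowsFaster U f v ib.1 (C ib) (x + s • u + t • v) ↔
          ∀ᶠ s : ℝ in 𝓝[>] 0, GrowsFaster U f v ib.1 (C ib) (x + s • u + t • v)) := by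
      rw [eventually_all]
      intro ib
      have h2 := (isTame_growsFaster hdef v ib.1 (C ib) (x + t • v) u 0).1
      simp only [add_right_comm x (t • v), Set.mem_ofPred_eq] at h2
      rcases h2 with h2 | h2
      · filter_upwards [h2] with s hs
        exact iff_of_true hs h2
      · filter_upwards [h2] with s hs
        refine iff_of_false hs fun h3 => ?_
        obtain ⟨s, h4, h5⟩ := (h2.and h3).exists
        exact h4 h5
    obtain ⟨δ, hδ, hδs⟩ := mem_nhdsGT_iff_exists_Ioo_subset.mp h1
    obtain ⟨k, hk⟩ := exists_nat_one_div_lt (show (0 : ℝ) < δ from hδ)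
    exact ⟨(k, _), fun s h0 h1 => hδs ⟨h0, h1.trans hk⟩⟩)
  obtain ⟨δ, hδ, hδV⟩ := Metric.isOpen_iff.mp hVo t₀ ht₀
  obtain ⟨p', hp₁, hp₂⟩ := exists_rat_btwn (show t₀ < t₀ + δ / 2 by linarith)
  obtain ⟨q', hq₁, hq₂⟩ := exists_rat_btwn (show t₀ + δ / 2 < t₀ + δ by linarith)
  have hpq' : (p' : ℝ) < q' := hp₂.trans hq₁
  have hV' : Icc (p' : ℝ) q' ⊆ V := fun t ht => hδV (by
    rw [Metric.mem_ball, Real.dist_eq, abs_lt]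
    constructor <;> linarith [ht.1, ht.2])
  have hin : Icc (p' : ℝ) q' ⊆ Icc p q :=
    fun t ht => Ioo_subset_Icc_self (hVpq (hV' ht))
  have hcl := (Ioo_subset_Icc_self.trans hV').trans hVT
  have hxu' : ∀ s : ℝ, 0 < s → s < r → ∀ t ∈ Icc (p' : ℝ) q', x + s • u + t • v ∈ U :=
    fun s h0 h1 t ht => hxu s h0 h1 t (hin ht)
  -- The outcome `σ` is known only for a dense set of `t`; for each fixed `s`, tameness in `t`
  -- extends it to the right of every point.
  have hge : ∀ ib, σ ib → ∀ s : ℝ, 0 < s → s < r → s < 1 / ((k : ℝ) + 1) →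
      ∀ t ∈ Icc (p' : ℝ) q', ∀ t' ∈ Icc (p' : ℝ) q', t ≤ t' →
      C ib * (t' - t) ≤ f (x + s • u + t' • v) ib.1 - f (x + s • u + t • v) ib.1 := by
    intro ib hσ s h0 h1 h2 t ht t' ht' htt'
    refine slope_ge_of_growsFaster hf (hxu' s h0 h1) ?_ ht ht' htt'
    exact (isTame_growsFaster hdef v ib.1 (C ib) (x + s • u) v).eventually_mem_of_subset_closure
      hcl fun τ hτ => (hτ s h0 h2 ib).mpr hσ
  have hle : ∀ ib, ¬ σ ib → ∀ s : ℝ, 0 < s → s < r → s < 1 / ((k : ℝ) + 1) →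
      ∀ t ∈ Icc (p' : ℝ) q', ∀ t' ∈ Icc (p' : ℝ) q', t ≤ t' →
      f (x + s • u + t' • v) ib.1 - f (x + s • u + t • v) ib.1 ≤ C ib * (t' - t) := by
    intro ib hσ s h0 h1 h2 t ht t' ht' htt'
    refine slope_le_of_not_growsFaster hU hf hdef (hxu' s h0 h1) ?_ ht ht' htt'
    exact (isTame_growsFaster hdef v ib.1 (C ib) (x + s • u)
      v).compl.eventually_mem_of_subset_closure hcl fun τ hτ h => hσ ((hτ s h0 h2 ib).mp h)
  have hsmall : ∀ᶠ s : ℝ in 𝓝[>] 0, 0 < s ∧ s < r ∧ s < 1 / ((k : ℝ) + 1) := by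
    filter_upwards [Ioo_mem_nhdsGT hr, Ioo_mem_nhdsGT (show (0 : ℝ) < 1 / ((k : ℝ) + 1) by
      positivity)] with s h1 h2 using ⟨h1.1, h1.2, h2.2⟩
  have hlim : ∀ i, Tendsto
      (fun s : ℝ => f (x + s • u + (q' : ℝ) • v) i - f (x + s • u + (p' : ℝ) • v) i) (𝓝[>] 0)
      (𝓝 (f (x + (q' : ℝ) • v) i - f (x + (p' : ℝ) • v) i)) := by
    intro i
    have h1 : ∀ t ∈ Icc (p' : ℝ) q', Tendsto (fun s : ℝ => f (x + s • u + t • v) i) (𝓝[>] 0)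
        (𝓝 (f (x + t • v) i)) := by
      intro t ht
      have h2 : ContinuousAt (fun y => f y i) (x + t • v) :=
        (EuclideanSpace.proj (𝕜 := ℝ) i).continuous.continuousAt.comp
          (hf.continuousAt (hU.mem_nhds (hx t (hin ht))))
      have h3 : Tendsto (fun s : ℝ => x + s • u + t • v) (𝓝 0) (𝓝 (x + t • v)) := by
        have : Continuous fun s : ℝ => x + s • u + t • v := by fun_prop
        simpa using this.tendsto 0
      exact (Tendsto.comp h2 h3).mono_left nhdsWithin_le_nhds
    exact (h1 _ (right_mem_Icc.mpr hpq'.le)).sub (h1 _ (left_mem_Icc.mpr hpq'.le))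
  have hbase : ∀ i, |f (x + (q' : ℝ) • v) i - f (x + (p' : ℝ) • v) i - w i * (q' - p')| ≤
      ε * (q' - p') := fun i => hs i _ (hin (left_mem_Icc.mpr hpq'.le)) _
        (hin (right_mem_Icc.mpr hpq'.le)) hpq'.le
  have hprod : 0 < ε * ((q' : ℝ) - p') := mul_pos hε (sub_pos.mpr hpq')
  -- Slopes at least `w i + 2 * ε` on the translates would pass, as `s → 0`, to the original
  -- segment.
  have hσt : ∀ i, ¬ σ (i, true) := by
    intro i hσ
    have h1 := ge_of_tendsto (hlim i) (hsmall.mono fun s h => hge (i, true) hσ s h.1 h.2.1 h.2.2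
      _ (left_mem_Icc.mpr hpq'.le) _ (right_mem_Icc.mpr hpq'.le) hpq'.le)
    have h2 := (abs_le.mp (hbase i)).2
    simp only [hC] at h1
    nlinarith
  have hσf : ∀ i, σ (i, false) := by
    intro i
    by_contra hσ
    have h1 := le_of_tendsto (hlim i) (hsmall.mono fun s h => hle (i, false) hσ s h.1 h.2.1 h.2.2
      _ (left_mem_Icc.mpr hpq'.le) _ (right_mem_Icc.mpr hpq'.le) hpq'.le)
    have h2 := (abs_le.mp (hbase i)).1
    simp only [hC] at h1
    nlinarith
  refine ⟨p', q', k, by exact_mod_cast hpq', (hin (left_mem_Icc.mpr hpq'.le)).1,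
    (hin (right_mem_Icc.mpr hpq'.le)).2, fun s h0 h1 h2 i t ht t' ht' htt' => ?_⟩
  have e₁ := hle _ (hσt i) s h0 h1 h2 t ht t' ht' htt'
  have e₂ := hge _ (hσf i) s h0 h1 h2 t ht t' ht' htt'
  simp only [hC] at e₁ e₂
  rw [abs_le]
  constructor <;> linarith

end Approximation

/-! ### Approximation by differentials -/

section Closure

variable {m n : ℕ} {U : Set (EuclideanSpace ℝ (Fin m))}
  {f : EuclideanSpace ℝ (Fin m) → EuclideanSpace ℝ (Fin n)}

theorem exists_tube (hU : IsOpen U) {x v : EuclideanSpace ℝ (Fin m)} {p q : ℝ}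
    (hx : ∀ t ∈ Icc p q, x + t • v ∈ U) :
    ∃ r > 0, ∀ z : EuclideanSpace ℝ (Fin m), ‖z‖ < r → ∀ t ∈ Icc p q, x + z + t • v ∈ U := by
  have hK : IsCompact ((fun t : ℝ => x + t • v) '' Icc p q) :=
    isCompact_Icc.image (by fun_prop)
  obtain ⟨r, hr, hrU⟩ := hK.exists_thickening_subset_open hU (by rintro _ ⟨t, ht, rfl⟩; exact hx t ht)
  refine ⟨r, hr, fun z hz t ht => hrU ?_⟩
  rw [Metric.mem_thickening_iff]
  refine ⟨x + t • v, ⟨t, ht, rfl⟩, ?_⟩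
  rwa [dist_eq_norm, show x + z + t • v - (x + t • v) = z by abel]

theorem tendsto_increment_of_hasFDerivAt {y : EuclideanSpace ℝ (Fin m)}
    {A : EuclideanSpace ℝ (Fin m) →L[ℝ] EuclideanSpace ℝ (Fin n)} (hA : HasFDerivAt f A y)
    (v : EuclideanSpace ℝ (Fin m)) :
    Tendsto (fun h : ℝ => h⁻¹ • (f (y + h • v) - f y)) (𝓝[>] 0) (𝓝 (A v)) := by
  have h1 : HasDerivAt (fun t : ℝ => f (y + t • v)) (A v) 0 := hA.hasLineDerivAt v
  simpa using h1.tendsto_slope_zero_right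

/-- Arbitrarily close to a segment on which the slopes of `f` are `ε`-close to `w`, there is a
point where `f` is differentiable with derivative along the segment `2 ε`-close to `w`. -/
theorem exists_differential_near (hU : IsOpen U) (hf : ContinuousOn f U)
    (hdef : IsDefinableMap U f) {x v : EuclideanSpace ℝ (Fin m)} {p q : ℝ} (hpq : p < q)
    (hx : ∀ t ∈ Icc p q, x + t • v ∈ U)
    {w : EuclideanSpace ℝ (Fin n)} {ε : ℝ} (hε : 0 < ε)
    (hs : ∀ i, ∀ t ∈ Icc p q, ∀ t' ∈ Icc p q, t ≤ t' →
      |f (x + t' • v) i - f (x + t • v) i - w i * (t' - t)| ≤ ε * (t' - t)) :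
    ∃ A ∈ differentials U f, ∀ i, |A v i - w i| ≤ 2 * ε := by
  obtain ⟨r, hr, htube⟩ := exists_tube hU hx
  have hxu : ∀ u ∈ Metric.ball (0 : EuclideanSpace ℝ (Fin m)) 1, ∀ s : ℝ, 0 < s → s < r →
      ∀ t ∈ Icc p q, x + s • u + t • v ∈ U := by
    intro u hu s h0 h1
    refine htube _ ?_
    rw [norm_smul, Real.norm_eq_abs, abs_of_pos h0]
    rw [mem_ball_zero_iff] at hu
    nlinarith [norm_nonneg u]
  -- Second use of Baire, now over the direction `u`: one interval and one bound on `s` serve a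
  -- dense subset of the open set `W`.
  obtain ⟨⟨p', q', k⟩, W, hWB, hWo, ⟨u₁, hu₁⟩, hWT⟩ := exists_isOpen_subset_closure
    (ι := ℚ × ℚ × ℕ) (W := Metric.ball (0 : EuclideanSpace ℝ (Fin m)) 1) Metric.isOpen_ball
    ⟨0, Metric.mem_ball_self one_pos⟩
    (T := fun j => {u | j.1 < j.2.1 ∧ p ≤ j.1 ∧ j.2.1 ≤ q ∧
      ∀ s : ℝ, 0 < s → s < r → s < 1 / ((j.2.2 : ℝ) + 1) → ∀ i, ∀ t ∈ Icc (j.1 : ℝ) j.2.1,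
        ∀ t' ∈ Icc (j.1 : ℝ) j.2.1, t ≤ t' →
        |f (x + s • u + t' • v) i - f (x + s • u + t • v) i - w i * (t' - t)| ≤
          2 * ε * (t' - t)}) (by
    intro u hu
    obtain ⟨p', q', k, h⟩ := exists_subinterval_slopes_near_translate hU hf hdef hpq hx hr
      (hxu u hu) hε hs
    exact ⟨(p', q', k), h⟩)
  obtain ⟨u₀, hu₀, hpq', hp', hq', -⟩ := mem_closure_iff.mp (hWT hu₁) W hWo hu₁
  dsimp only at hpq' hp' hq' hWT
  have hpq'' : (p' : ℝ) < q' := by exact_mod_cast hpq'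
  have hin : Icc (p' : ℝ) q' ⊆ Icc p q := Icc_subset_Icc hp' hq'
  have hW : ∀ u ∈ W, ∀ s : ℝ, 0 < s → s < r → s < 1 / ((k : ℝ) + 1) → ∀ i,
      ∀ t ∈ Icc (p' : ℝ) q', ∀ t' ∈ Icc (p' : ℝ) q', t ≤ t' →
        |f (x + s • u + t' • v) i - f (x + s • u + t • v) i - w i * (t' - t)| ≤
          2 * ε * (t' - t) := by
    intro u hu s h0 h1 h2 i t ht t' ht' htt'
    have hct : ∀ t ∈ Icc (p' : ℝ) q', ContinuousAt (fun z => f (x + s • z + t • v) i) u := by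
      intro t ht
      have h3 : ContinuousAt f (x + s • u + t • v) :=
        hf.continuousAt (hU.mem_nhds (hxu u (hWB hu) s h0 h1 t (hin ht)))
      have h4 : ContinuousAt (fun z => f (x + s • z + t • v)) u :=
        ContinuousAt.comp (f := fun z => x + s • z + t • v) h3 (by fun_prop)
      exact (EuclideanSpace.proj (𝕜 := ℝ) i).continuous.continuousAt.comp h4
    have hc := (((hct t' ht').sub (hct t ht)).sub
      (continuousAt_const (y := w i * (t' - t)))).abs
    by_contra! hlt
    obtain ⟨z, hz, -, -, -, hz'⟩ := mem_closure_iff_nhds.mp (hWT hu) _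
      (hc.eventually (lt_mem_nhds hlt))
    exact (hz' s h0 h1 h2 i t ht t' ht' htt').not_gt hz
  -- With `s` and `t` fixed, the points `x + s • u + t • v`, `u ∈ W`, form an open set, in which a
  -- point of differentiability is chosen; `hback` recovers `u` from the point.
  obtain ⟨s, h0, hs'⟩ := exists_between (show (0 : ℝ) < min r (1 / ((k : ℝ) + 1)) from
    lt_min hr (by positivity))
  obtain ⟨h1, h2⟩ := lt_min_iff.mp hs'
  obtain ⟨t, ht₁, ht₂⟩ := exists_between hpq''
  have ht : t ∈ Icc (p' : ℝ) q' := ⟨ht₁.le, ht₂.le⟩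
  have hback : ∀ y : EuclideanSpace ℝ (Fin m), x + s • (s⁻¹ • (y - x - t • v)) + t • v = y := by
    intro y
    rw [smul_inv_smul₀ h0.ne']
    abel
  obtain ⟨y, hyW, hyd⟩ := exists_differentiableAt hU hf hdef
    (V := (fun y => s⁻¹ • (y - x - t • v)) ⁻¹' W) (hWo.preimage (by fun_prop))
    ⟨x + s • u₀ + t • v, by
      have : s⁻¹ • (x + s • u₀ + t • v - x - t • v) = u₀ := by
        rw [show x + s • u₀ + t • v - x - t • v = s • u₀ by abel, inv_smul_smul₀ h0.ne']
      rw [mem_preimage, this]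
      exact hu₀⟩
    (fun y hy => by
      have := hxu _ (hWB hy) s h0 h1 t (hin ht)
      rwa [hback] at this)
  have hyU : y ∈ U := by
    have := hxu _ (hWB hyW) s h0 h1 t (hin ht)
    rwa [hback] at this
  refine ⟨fderiv ℝ f y, ⟨y, hyU, hyd.hasFDerivAt⟩, fun i => ?_⟩
  have hlim : Tendsto (fun h : ℝ => |(h⁻¹ • (f (y + h • v) - f y)) i - w i|) (𝓝[>] 0)
      (𝓝 |fderiv ℝ f y v i - w i|) :=
    ((((EuclideanSpace.proj (𝕜 := ℝ) i).continuous.tendsto _).comp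
      (tendsto_increment_of_hasFDerivAt hyd.hasFDerivAt v)).sub_const _).abs
  refine le_of_tendsto hlim ?_
  filter_upwards [Ioo_mem_nhdsGT (sub_pos.mpr ht₂)] with h hh
  have h3 := hW _ hyW s h0 h1 h2 i t ht (t + h) ⟨by linarith [hh.1], by linarith [hh.2]⟩
    (by linarith [hh.1])
  rw [hback, add_smul, ← add_assoc, hback, add_sub_cancel_left] at h3
  have e : (h⁻¹ • (f (y + h • v) - f y)) i - w i =
      h⁻¹ * (f (y + h • v) i - f y i - w i * h) := by
    have := hh.1.ne'
    simp only [PiLp.smul_apply, PiLp.sub_apply, smul_eq_mul]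
    field_simp
  rw [e, abs_mul, abs_of_pos (inv_pos.mpr hh.1), inv_mul_le_iff₀ hh.1]
  linarith

theorem mem_closure_differentialsAlong (hU : IsOpen U) (hf : ContinuousOn f U)
    (hdef : IsDefinableMap U f) {x v : EuclideanSpace ℝ (Fin m)} {a b : ℝ} (hab : a < b)
    (hx : ∀ t ∈ Icc a b, x + t • v ∈ U) {w : EuclideanSpace ℝ (Fin n)} {t : ℝ}
    (ht : t ∈ Icc a b) (hw : HasDerivWithinAt (fun s : ℝ => f (x + s • v)) w (Icc a b) t) :
    w ∈ closure (differentialsAlong U f v) := by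
  rw [mem_closure_iff_nhds]
  intro N hN
  have h1 : (WithLp.toLp 2 : (Fin n → ℝ) → EuclideanSpace ℝ (Fin n)) ⁻¹' N ∈
      𝓝 (fun l => w l) :=
    (PiLp.continuous_toLp 2 _).continuousAt.preimage_mem_nhds hN
  obtain ⟨r, hr, hrN⟩ := Metric.nhds_basis_closedBall.mem_iff.mp h1
  -- With `ε = r / 2` the final error `2 * ε` is `r`.
  obtain ⟨p, q, hp, hpq, hq, hs⟩ := exists_interval_slopes_near hU hf hdef hab hx ht hw (half_pos hr)
  obtain ⟨A, hA, hAw⟩ := exists_differential_near hU hf hdef hpq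
    (fun t ht => hx t ⟨hp.trans ht.1, ht.2.trans hq⟩) (half_pos hr) hs
  refine ⟨A v, ?_, A, hA, rfl⟩
  have : (fun l => A v l) ∈ Metric.closedBall (fun l => w l) r := by
    refine (dist_pi_le_iff hr.le).mpr fun i => ?_
    rw [Real.dist_eq]
    linarith [hAw i]
  exact hrN this

end Closure

/-- Derivatives of `g(t) = f(x + t v)` on `[a, b]` are one-sided at the end points. -/
theorem lemma4p3 {m n : ℕ} (U : Set (EuclideanSpace ℝ (Fin m))) (hU : IsOpen U)
    (f : EuclideanSpace ℝ (Fin m) → EuclideanSpace ℝ (Fin n))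
    (hf : ContinuousOn f U) (hdef : IsDefinableMap U f)
    (v : EuclideanSpace ℝ (Fin m)) (hv : ‖v‖ = 1) :
    (∀ x ∈ U, ∀ a b : ℝ, a < b → (∀ t ∈ Icc a b, x + t • v ∈ U) →
      ∀ t ∈ Icc a b, ∀ w : EuclideanSpace ℝ (Fin n),
        HasDerivWithinAt (fun s : ℝ => f (x + s • v)) w (Icc a b) t →
          w ∈ closure (differentialsAlong U f v)) ∧
    closure (directionalDerivs U f v) = closure (differentialsAlong U f v) := by
  refine ⟨fun x _ a b hab hx t ht w hw =>
    mem_closure_differentialsAlong hU hf hdef hab hx ht hw, subset_antisymm ?_ ?_⟩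
  · refine closure_minimal ?_ isClosed_closure
    rintro w ⟨y, hy, hw⟩
    have hcont : Tendsto (fun t : ℝ => y + t • v) (𝓝 0) (𝓝 y) := by
      have : Continuous fun t : ℝ => y + t • v := by fun_prop
      simpa using this.tendsto 0
    obtain ⟨δ, hδ, hδU⟩ := Metric.nhds_basis_closedBall.mem_iff.mp (hcont (hU.mem_nhds hy))
    -- The directional derivative is the one-sided derivative at the left end of `[0, δ]`.
    refine mem_closure_differentialsAlong hU hf hdef (x := y) hδ (fun t ht => hδU ?_)
      (left_mem_Icc.mpr hδ.le) ?_
    · rw [mem_closedBall_zero_iff, Real.norm_eq_abs, abs_of_nonneg ht.1]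
      exact ht.2
    · have h1 : HasDerivWithinAt (fun s : ℝ => f (y + s • v)) w (Ioi 0) 0 := by
        rw [hasDerivWithinAt_iff_tendsto_slope' (by simp)]
        refine hw.congr fun h => ?_
        simp [slope_def_module]
      exact (hasDerivWithinAt_Ioi_iff_Ici.mp h1).mono Icc_subset_Ici_self
  · refine closure_mono ?_
    rintro w ⟨A, ⟨y, hy, hA⟩, rfl⟩
    exact ⟨y, hy, tendsto_increment_of_hasFDerivAt hA v⟩
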